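/- **Setting.** All Hilbert spaces are finite dimensional. Let $\Lambda:\mathcal B(\bigotimes_{i=1}^k\mathcal H_i)\to\mathcal B(\bigotimes_{r=1}^m\mathcal K_r)$ be a quantum channel (completely positive, trace preserving) with $k$ senders and $m$ receivers, used as a memoryless channel $\Lambda^{\otimes n}$. Sender $i$ holds $l_i$ subsystems $(i,\alpha)$, $1\le\alpha\le l_i$, and every subsystem $(i,\alpha)$ has a prescribed destination, one of the $m$ receivers (so each sender may send to any of the receivers). Put $L=\sum_i l_i$. *Sources.* For each subsystem $f=(i,\alpha)$ fix a space $\mathcal H_{A_f}$. A source is, for every $n$ and $f$, a unit vector $\Psi_f^{(n)}$ in (finite-dimensional reference)$\,\otimes\mathcal H_{A_f}^{\otimes n}$, with reduced state $\varrho_f^{(n)}$ on $\mathcal H_{A_f}^{\otimes n}$. It has rates $(R_f)_f$ if $\lim_n S(\varrho_f^{(n)})/n=R_f$ for all $f$, where $S(\varrho)=-\mathrm{tr}\,\varrho\log_2\varrho$. For a completely positive map $\Phi$ on $\bigotimes_f\mathcal H_{A_f}^{\otimes n}$, the entanglement fidelity is $F_e(\Psi,\Phi)=\langle\Psi|(\mathrm{id}\otimes\Phi)(|\Psi\rangle\langle\Psi|)|\Psi\rangle$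 with $\Psi=\bigotimes_f\Psi^{(n)}_f$. *Zero-way codes.* Sender $i$ applies a channel $\varepsilon_i:\mathcal B(\bigotimes_\alpha\mathcal H_{A_{(i,\alpha)}}^{\otimes n})\to\mathcal B(\mathcal H_i^{\otimes n})$, and receiver $r$ applies a channel $D_r$ from $\mathcal B(\mathcal K_r^{\otimes n})$ to the operators on the tensor product of the spaces $\mathcal H_{A_f}^{\otimes n}$ of the subsystems $f$ destined for $r$. The effective map is $(\bigotimes_r D_r)\,\Lambda^{\otimes n}\,(\bigotimes_i\varepsilon_i)$. *Codes with forward classical communication.* There is a finite set of classical messages $j$, sent noiselessly to all receivers; for each $j$ there are completely positive maps $\varepsilon_i^{j}$ and channels $D_r^{j}$ on the same spaces as above such that $\sum_j\bigotimes_i\varepsilon_i^{j}$ is trace preserving. The effective map is $\sum_j(\bigotimes_r D^{j}_r)\,\Lambda^{\otimes n}\,(\bigotimes_i\varepsilon^{j}_i)$. The code is *local* if $j=(j_1,\dots,j_k)$ ranges over a product set, $\varepsilon_i^j$ depends only on $j_i$, and $\sum_{j_i}\varepsilon_i^{j_i}$ is trace preserving for every $i$ (each sender generates its own message). A sequence of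 codes is reliable for a source if the global entanglement fidelity of the effective maps tends to $1$ as $n\to\infty$. The entanglement-transmission capacity region for a class of codes is the set of all $L$-tuples $(R_f)_f$ of rates of sources (over all choices of the spaces $\mathcal H_{A_f}$) for which a reliable sequence of codes of this class exists. **Theorem.** For every such channel $\Lambda$, all $l_1,\dots,l_k$ and all assignments of destinations: 1. The capacity region with local codes using forward classical communication equals the zero-way capacity region. 2. The same holds for the capacity region with arbitrary (not necessarily local) codes using forward classical communication. 3. For every source and every sequence of codes with forward classical communication that is reliable for it, there are messages $j(n)$, partial isometries $W_i^{(n)}:\bigotimes_\alpha\mathcal H_{A_{(i,\alpha)}}^{\otimes n}\to\mathcal H_i^{\otimes n}$ and channels $\tilde\varepsilon_i^{(n)}$ such that $\tilde\varepsilon_i^{(n)}-W_i^{(n)}(\cdot)W_i^{(n)\dagger}$ is completely positive, and such that, for the same source (hence at the same rates), the entanglement fidelity tends to $1$ both for the encodings $\bigotimes_iW_i^{(n)}(\cdot)W_i^{(n)\dagger}$ and for the zero-way codes with encodings $\bigotimes_i\tilde\varepsilon_i^{(n)}$, in each case with the decodings $\bigotimes_rD_r^{j(n)}$. In particular ($m=1$)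 the zero-way capacity region of any multiple access channel is also its capacity region with forward classical assistance. -/

import Mathlib

open Filter Topology
open scoped ComplexOrder Matrix

noncomputable section

namespace MultiUser

/-! ### Finite-dimensional quantum operations

A finite-dimensional Hilbert space is given by a finite type labelling an orthonormal basis; its
operators are complex matrices, and the tensor product of spaces is given by the (dependent)
product of the label types. -/

/-- Linear maps `B(ℂ^X) → B(ℂ^Y)`. -/
abbrev Superop (X Y : Type) : Type := Matrix X X ℂ →ₗ[ℂ] Matrix Y Y ℂ

/-- The map `id_R ⊗ Φ`. -/
def ampl (R : Type) {X Y : Type} (Φ : Superop X Y) : Superop (R × X) (R × Y) where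
  toFun M := Matrix.of fun p q => Φ (Matrix.of fun x x' => M (p.1, x) (q.1, x')) p.2 q.2
  map_add' M N := by
    ext p q
    have h : (Matrix.of fun x x' => (M + N) (p.1, x) (q.1, x')) =
        (Matrix.of fun x x' => M (p.1, x) (q.1, x')) +
          Matrix.of fun x x' => N (p.1, x) (q.1, x') := rfl
    simp only [Matrix.of_apply, Matrix.add_apply]
    rw [← Matrix.add_apply, ← map_add, ← h]
    rfl
  map_smul' c M := by
    ext p q
    have h : (Matrix.of fun x x' => (c • M) (p.1, x) (q.1, x')) =
        c • (Matrix.of fun x x' => M (p.1, x) (q.1, x')) := rfl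
    simp only [Matrix.of_apply, Matrix.smul_apply, RingHom.id_apply]
    rw [← Matrix.smul_apply, ← map_smul, ← h]
    rfl

/-- Complete positivity: `id ⊗ Φ` preserves positivity for every ancilla dimension. -/
def IsCompletelyPositive {X Y : Type} (Φ : Superop X Y) : Prop :=
  ∀ (r : ℕ) (M : Matrix (Fin r × X) (Fin r × X) ℂ),
    M.PosSemidef → (ampl (Fin r) Φ M).PosSemidef

def IsTracePreserving {X Y : Type} [Fintype X] [Fintype Y] (Φ : Superop X Y) : Prop :=
  ∀ M : Matrix X X ℂ, (Φ M).trace = M.trace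

/-- A quantum channel: completely positive and trace preserving. -/
def IsChannel {X Y : Type} [Fintype X] [Fintype Y] (Φ : Superop X Y) : Prop :=
  IsCompletelyPositive Φ ∧ IsTracePreserving Φ

/-- The operation `ρ ↦ W ρ W†`. -/
def conjBy {X Y : Type} [Fintype X] (W : Matrix Y X ℂ) : Superop X Y where
  toFun M := W * M * Wᴴ
  map_add' M N := by rw [Matrix.mul_add, Matrix.add_mul]
  map_smul' c M := by simp

/-- `W` is a partial isometry. -/
def IsPartialIsometry {X Y : Type} [Fintype X] [Fintype Y] (W : Matrix Y X ℂ) : Prop :=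
  W * Wᴴ * W = W

/-- Change of basis labels along `g` (used below only for bijections `g`, which rearrange tensor
factors). -/
def relabel {X Y : Type} (g : Y → X) : Superop X Y where
  toFun M := M.submatrix g g
  map_add' _ _ := rfl
  map_smul' _ _ := rfl

/-- The tensor product `⨂ᵢ Φᵢ` of a finite family of maps; see `tensorMap_pi`. -/
def tensorMap {ι : Type} [Fintype ι] [DecidableEq ι] {X Y : ι → Type}
    [∀ i, Fintype (X i)] [∀ i, DecidableEq (X i)] (Φ : ∀ i, Superop (X i) (Y i)) :
    Superop (∀ i, X i) (∀ i, Y i) where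
  toFun M := Matrix.of fun y y' =>
    ∑ x, ∑ x', M x x' * ∏ i, Φ i (Matrix.single (x i) (x' i) 1) (y i) (y' i)
  map_add' M N := by
    ext y y'
    simp [add_mul, Finset.sum_add_distrib]
  map_smul' c M := by
    ext y y'
    simp [mul_assoc, Finset.mul_sum]

/-- `tensorMap` acts on product operators factor by factor. -/
theorem tensorMap_pi {ι : Type} [Fintype ι] [DecidableEq ι] {X Y : ι → Type}
    [∀ i, Fintype (X i)] [∀ i, DecidableEq (X i)] (Φ : ∀ i, Superop (X i) (Y i))
    (M : ∀ i, Matrix (X i) (X i) ℂ) :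
    tensorMap Φ (Matrix.of fun x x' => ∏ i, M i (x i) (x' i)) =
      Matrix.of fun y y' => ∏ i, Φ i (M i) (y i) (y' i) := by
  ext y y'
  have key : ∀ i, Φ i (M i) (y i) (y' i) =
      ∑ s, ∑ t, M i s t * Φ i (Matrix.single s t 1) (y i) (y' i) := by
    intro i
    conv_lhs => rw [Matrix.matrix_eq_sum_single (M i)]
    rw [map_sum, Matrix.sum_apply]
    refine Finset.sum_congr rfl fun s _ => ?_
    rw [map_sum, Matrix.sum_apply]
    refine Finset.sum_congr rfl fun t _ => ?_
    have h : Matrix.single s t (M i s t) = M i s t • Matrix.single s t (1 : ℂ) := by simp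
    rw [h, map_smul, Matrix.smul_apply, smul_eq_mul]
  simp only [tensorMap, LinearMap.coe_mk, AddHom.coe_mk, Matrix.of_apply, key]
  rw [Finset.prod_univ_sum, Fintype.piFinset_univ]
  refine Finset.sum_congr rfl fun x _ => ?_
  rw [Finset.prod_univ_sum, Fintype.piFinset_univ]
  refine Finset.sum_congr rfl fun x' _ => ?_
  rw [Finset.prod_mul_distrib]

/-- The memoryless extension `Λ^{⊗n}`. -/
def tensorPow {X Y : Type} [Fintype X] [DecidableEq X] (Λ : Superop X Y) (n : ℕ) :
    Superop (Fin n → X) (Fin n → Y) :=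
  tensorMap fun _ => Λ

/-! ### States -/

/-- The reduced state on the second factor of the pure state `ψ` of a bipartite system. -/
def reduced {R X : Type} [Fintype R] (ψ : R × X → ℂ) : Matrix X X ℂ :=
  Matrix.of fun x x' => ∑ r, ψ (r, x) * star (ψ (r, x'))

theorem reduced_isHermitian {R X : Type} [Fintype R] (ψ : R × X → ℂ) :
    (reduced ψ).IsHermitian := by
  ext x x'
  simp [reduced, Matrix.conjTranspose_apply, mul_comm]

/-- The von Neumann entropy `-tr ρ log₂ ρ`. -/
def vonNeumannEntropy {X : Type} [Fintype X] [DecidableEq X] {ρ : Matrix X X ℂ}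
    (hρ : ρ.IsHermitian) : ℝ :=
  (∑ x, Real.negMulLog (hρ.eigenvalues x)) / Real.log 2

/-- The entanglement fidelity `⟨ψ| (id ⊗ Φ)(|ψ⟩⟨ψ|) |ψ⟩`. -/
def entanglementFidelity {R X : Type} [Fintype R] [Fintype X] (ψ : R × X → ℂ)
    (Φ : Superop X X) : ℝ :=
  (star ψ ⬝ᵥ (ampl R Φ (Matrix.vecMulVec ψ (star ψ)) *ᵥ ψ)).re

/-! ### Networks with `k` senders and `m` receivers -/

variable {k m : ℕ}

/-- The transmissions: `⟨i, α⟩` is the `α`-th of the `l i` subsystems held by sender `i`. -/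
abbrev Flow (l : Fin k → ℕ) : Type := Σ i : Fin k, Fin (l i)

/-- Basis labels of the `n`-fold tensor power of `ℂ^d`. -/
abbrev Blk (d n : ℕ) : Type := Fin n → Fin d

/-- Input space of the network channel: sender `i` controls a factor of dimension `a i`. -/
abbrev ChIn (a : Fin k → ℕ) : Type := ∀ i, Fin (a i)

/-- Output space of the network channel: receiver `r` gets a factor of dimension `b r`. -/
abbrev ChOut (b : Fin m → ℕ) : Type := ∀ r, Fin (b r)

/-- The source space of sender `i` for blocks of length `n`. -/
abbrev SenderSpace (l : Fin k → ℕ) (d : Flow l → ℕ) (n : ℕ) (i : Fin k) : Type :=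
  ∀ α : Fin (l i), Blk (d ⟨i, α⟩) n

/-- The target space of receiver `r`: the subsystems whose destination is `r`. -/
abbrev ReceiverSpace (l : Fin k → ℕ) (dst : Flow l → Fin m) (d : Flow l → ℕ) (n : ℕ)
    (r : Fin m) : Type :=
  ∀ f : {f : Flow l // dst f = r}, Blk (d f.1) n

/-- The joint space of all transmitted subsystems. -/
abbrev TotalSpace (l : Fin k → ℕ) (d : Flow l → ℕ) (n : ℕ) : Type := ∀ f : Flow l, Blk (d f) n

/-- For each transmission `f`, a unit vector `Ψ_f` in (reference) ⊗ (`n`-th tensor power of the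
source space, of dimension `d f`); the second part is to be transmitted. -/
structure BlockSource (l : Fin k → ℕ) (d : Flow l → ℕ) (n : ℕ) where
  refDim : Flow l → ℕ
  psi : ∀ f, Fin (refDim f) × Blk (d f) n → ℂ
  unit : ∀ f, ∑ z, ‖psi f z‖ ^ 2 = 1

namespace BlockSource

variable {l : Fin k → ℕ} {d : Flow l → ℕ} {n : ℕ}

/-- The vector `⨂_f Ψ_f`. -/
def total (s : BlockSource l d n) : (∀ f, Fin (s.refDim f)) × TotalSpace l d n → ℂ :=
  fun z => ∏ f, s.psi f (z.1 f, z.2 f)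

/-- The entropy of the transmitted part of `Ψ_f`. -/
def entropy (s : BlockSource l d n) (f : Flow l) : ℝ :=
  vonNeumannEntropy (reduced_isHermitian (s.psi f))

end BlockSource

/-- The families of local encoders, sender `i` mapping its source space to the `n`-fold channel
input under its control. -/
abbrev Encoders (a : Fin k → ℕ) (l : Fin k → ℕ) (d : Flow l → ℕ) (n : ℕ) : Type :=
  ∀ i, Superop (SenderSpace l d n i) (Blk (a i) n)

/-- The families of local decoders. -/
abbrev Decoders (b : Fin m → ℕ) (l : Fin k → ℕ) (dst : Flow l → Fin m) (d : Flow l → ℕ)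
    (n : ℕ) : Type :=
  ∀ r, Superop (Blk (b r) n) (ReceiverSpace l dst d n r)

/-- The end-to-end map `(⨂_r D_r) ∘ Λ^{⊗n} ∘ (⨂_i E_i)`, the relabellings being the canonical
rearrangements of tensor factors. -/
def endToEnd {a : Fin k → ℕ} {b : Fin m → ℕ} {l : Fin k → ℕ} {dst : Flow l → Fin m}
    {d : Flow l → ℕ} {n : ℕ} (Λ : Superop (ChIn a) (ChOut b))
    (E : Encoders a l d n) (D : Decoders b l dst d n) :
    Superop (TotalSpace l d n) (TotalSpace l d n) :=
  relabel (fun (g : TotalSpace l d n) (r : Fin m) (f : {f : Flow l // dst f = r}) => g f.1) ∘ₗ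
  tensorMap D ∘ₗ
  relabel (fun (y : ∀ r, Blk (b r) n) (t : Fin n) (r : Fin m) => y r t) ∘ₗ
  tensorPow Λ n ∘ₗ
  relabel (fun (x : Fin n → ChIn a) (i : Fin k) (t : Fin n) => x t i) ∘ₗ
  tensorMap E ∘ₗ
  relabel (fun (g : ∀ i, SenderSpace l d n i) (f : Flow l) => g f.1 f.2)

/-- A zero-way block code: local encoding channels and local decoding channels. -/
structure ZeroWayCode (a : Fin k → ℕ) (b : Fin m → ℕ) (l : Fin k → ℕ) (dst : Flow l → Fin m)
    (d : Flow l → ℕ) (n : ℕ) where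
  enc : Encoders a l d n
  dec : Decoders b l dst d n
  enc_channel : ∀ i, IsChannel (enc i)
  dec_channel : ∀ r, IsChannel (dec r)

/-- A block code assisted by noiseless forward classical communication: for each classical message
`j` (heard by all receivers) completely positive local encodings and local decoding channels, where
`∑ⱼ ⨂ᵢ (enc j i)` is trace preserving. -/
structure ForwardCode (a : Fin k → ℕ) (b : Fin m → ℕ) (l : Fin k → ℕ) (dst : Flow l → Fin m)
    (d : Flow l → ℕ) (n : ℕ) where
  numMsg : ℕ
  enc : Fin numMsg → Encoders a l d n
  dec : Fin numMsg → Decoders b l dst d n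
  enc_cp : ∀ j i, IsCompletelyPositive (enc j i)
  enc_tp : IsTracePreserving (∑ j, tensorMap (enc j))
  dec_channel : ∀ j r, IsChannel (dec j r)

section Codes

variable {a : Fin k → ℕ} {b : Fin m → ℕ} {l : Fin k → ℕ} {dst : Flow l → Fin m} {d : Flow l → ℕ}
  {n : ℕ}

/-- The effective channel of a zero-way code. -/
def ZeroWayCode.effective (P : ZeroWayCode a b l dst d n) (Λ : Superop (ChIn a) (ChOut b)) :
    Superop (TotalSpace l d n) (TotalSpace l d n) :=
  endToEnd Λ P.enc P.dec

/-- The effective channel of a forward-assisted code, a sum over the messages. -/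
def ForwardCode.effective (P : ForwardCode a b l dst d n) (Λ : Superop (ChIn a) (ChOut b)) :
    Superop (TotalSpace l d n) (TotalSpace l d n) :=
  ∑ j, endToEnd Λ (P.enc j) (P.dec j)

/-- The message is a tuple `(j₁, …, j_k)`, where `jᵢ` is the outcome of a quantum instrument that
sender `i` applies on its own (so that the senders share no randomness). -/
def ForwardCode.IsLocal (P : ForwardCode a b l dst d n) : Prop :=
  ∃ (X : Fin k → ℕ) (e : Fin P.numMsg ≃ ∀ i, Fin (X i))
    (E : ∀ i, Fin (X i) → Superop (SenderSpace l d n i) (Blk (a i) n)),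
    (∀ i, IsTracePreserving (∑ x, E i x)) ∧ ∀ j i, P.enc j i = E i (e j i)

end Codes

/-! ### Capacity regions for entanglement transmission

A rate tuple is achievable if, for some fixed source dimensions, some sequence of block sources has
these entropy rates and is transmitted with global entanglement fidelity tending to one. -/

/-- The source sequence `s` has entropy rates `R`. -/
def HasRates {l : Fin k → ℕ} {d : Flow l → ℕ} (s : ∀ n, BlockSource l d n) (R : Flow l → ℝ) :
    Prop :=
  ∀ f, Tendsto (fun n : ℕ => (s n).entropy f / n) atTop (𝓝 (R f))

/-- The zero-way capacity region. -/
def zeroWayRegion {a : Fin k → ℕ} {b : Fin m → ℕ} (Λ : Superop (ChIn a) (ChOut b))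
    (l : Fin k → ℕ) (dst : Flow l → Fin m) : Set (Flow l → ℝ) :=
  {R | ∃ (d : Flow l → ℕ) (s : ∀ n, BlockSource l d n) (P : ∀ n, ZeroWayCode a b l dst d n),
    HasRates s R ∧
    Tendsto (fun n => entanglementFidelity (s n).total ((P n).effective Λ)) atTop (𝓝 1)}

/-- The capacity region with forward classical communication, for the most general splitting of the
encoding into product branches (including those that need shared randomness of the senders). -/
def jointForwardRegion {a : Fin k → ℕ} {b : Fin m → ℕ} (Λ : Superop (ChIn a) (ChOut b))
    (l : Fin k → ℕ) (dst : Flow l → Fin m) : Set (Flow l → ℝ) :=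
  {R | ∃ (d : Flow l → ℕ) (s : ∀ n, BlockSource l d n) (P : ∀ n, ForwardCode a b l dst d n),
    HasRates s R ∧
    Tendsto (fun n => entanglementFidelity (s n).total ((P n).effective Λ)) atTop (𝓝 1)}

/-- The capacity region with forward classical communication, each sender generating its own
message. -/
def forwardRegion {a : Fin k → ℕ} {b : Fin m → ℕ} (Λ : Superop (ChIn a) (ChOut b))
    (l : Fin k → ℕ) (dst : Flow l → Fin m) : Set (Flow l → ℝ) :=
  {R | ∃ (d : Flow l → ℕ) (s : ∀ n, BlockSource l d n) (P : ∀ n, ForwardCode a b l dst d n),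
    (∀ n, (P n).IsLocal) ∧ HasRates s R ∧
    Tendsto (fun n => entanglementFidelity (s n).total ((P n).effective Λ)) atTop (𝓝 1)}

end MultiUser

end

open MultiUser

/-!
Write all operations in Kraus form. The entanglement fidelity of `∑ₛ Kₛ · Kₛ†` is then
`∑ₛ |tr Kₛ ρ|²`, where `ρ` is the reduced state (`entanglementFidelity_krausMap`); here `ρ` is a
product over the senders.

Splitting the encodings of a forward-assisted code into Kraus operators writes its fidelity `F` as a
sum over branches, each given by a message and one product operator `A = ⨂ᵢ Aᵢ` and occurring with
probability `p = tr A ρ A†`. The fidelity of a branch is at most its probability, so some branch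
with `p > 0` has fidelity at least `p F` (`exists_pos_mul_sum_le`). Take the polar decompositions
`Aᵢ ρᵢ = Wᵢ Pᵢ`. They multiply to `A ρ = W P` with `W = ⨂ᵢ Wᵢ` and `P = ⨂ᵢ Pᵢ`, so `W` is a product
of local partial isometries.

By the Cauchy–Schwarz inequality (`sum_norm_trace_sq_le`), no decoding can recover the branch with
fidelity above `(tr P)²`. Hence `tr W† A ρ = tr P ≥ √(p F)`, which makes `√p W` close to `A` in the
Hilbert–Schmidt norm weighted by `ρ`. A second use of the Cauchy–Schwarz inequality shows that the
encoding `W`, with the decoders of the chosen branch, has fidelity `F'` satisfying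
`√F' ≥ √F - √(2 (1 - √F))` (`sqrt_fidelity_polar_ge`), a bound that tends to `1` as `F → 1`.
Finally each `Wᵢ · Wᵢ†` is completed to a channel by preparing a fixed state on the complement of
the initial space of `Wᵢ`; the added Kraus operators can only increase the fidelity. This turns
every forward-assisted code into a zero-way code for the same source
(`ForwardCode.exists_zeroWayCode`); conversely, a zero-way code is a local forward-assisted code
with one message.
-/

noncomputable section

namespace MultiUser

/-! ### Kraus decompositions -/

section Kraus

variable {X Y Z ι κ : Type}

/-- The completely positive map `M ↦ ∑ₛ Kₛ M Kₛ†`. -/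
def krausMap [Fintype X] [Fintype ι] (K : ι → Matrix Y X ℂ) : Superop X Y :=
  ∑ s, conjBy (K s)

theorem krausMap_apply [Fintype X] [Fintype ι] (K : ι → Matrix Y X ℂ) (M : Matrix X X ℂ) :
    krausMap K M = ∑ s, K s * M * (K s)ᴴ := by
  simp [krausMap, conjBy]

theorem ampl_sum {α : Type} (s : Finset α) (R : Type) (Φ : α → Superop X Y)
    (M : Matrix (R × X) (R × X) ℂ) :
    ampl R (∑ i ∈ s, Φ i) M = ∑ i ∈ s, ampl R (Φ i) M := by
  ext p q
  simp [ampl, Matrix.sum_apply]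

theorem ampl_conjBy [Fintype X] (R : Type) [Fintype R] [DecidableEq R] (K : Matrix Y X ℂ)
    (M : Matrix (R × X) (R × X) ℂ) :
    ampl R (conjBy K) M =
      Matrix.kronecker (1 : Matrix R R ℂ) K * M * (Matrix.kronecker (1 : Matrix R R ℂ) K)ᴴ := by
  ext ⟨r, y⟩ ⟨r', y'⟩
  simp [ampl, conjBy, Matrix.mul_apply, Fintype.sum_prod_type, Matrix.one_apply,
    Finset.sum_mul, apply_ite, ite_mul]

theorem isCompletelyPositive_krausMap [Fintype X] [Fintype Y] [Fintype ι]
    (K : ι → Matrix Y X ℂ) : IsCompletelyPositive (krausMap K) := by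
  intro r M hM
  rw [krausMap, ampl_sum]
  refine Matrix.posSemidef_sum _ fun s _ => ?_
  rw [ampl_conjBy]
  exact hM.mul_mul_conjTranspose_same _

open scoped MatrixOrder in
theorem exists_eq_conjTranspose_mul_self [Fintype X] {M : Matrix X X ℂ} (h : M.PosSemidef) :
    ∃ B : Matrix X X ℂ, M = Bᴴ * B := by
  classical
  exact CStarAlgebra.nonneg_iff_eq_star_mul_self.1 h.nonneg

/-- Choi's theorem: the Kraus operators are read off from a factorization of the Choi matrix. -/
theorem IsCompletelyPositive.exists_kraus [Fintype X] [DecidableEq X] [Fintype Y]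
    {Φ : Superop X Y} (h : IsCompletelyPositive Φ) :
    ∃ K : X × Y → Matrix Y X ℂ, Φ = krausMap K := by
  classical
  let e := Fintype.equivFin X
  have hΩ := h (Fintype.card X)
    (Matrix.vecMulVec (fun p => if e p.2 = p.1 then (1 : ℂ) else 0)
      (star fun p => if e p.2 = p.1 then (1 : ℂ) else 0)) (Matrix.posSemidef_vecMulVec_self_star _)
  have hC : (Matrix.of fun p q : X × Y => Φ (Matrix.single p.1 q.1 1) p.2 q.2).PosSemidef := by
    convert hΩ.submatrix (fun p : X × Y => (e p.1, p.2)) using 1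
    ext ⟨x, y⟩ ⟨x', y'⟩
    simp only [ampl, Matrix.of_apply, LinearMap.coe_mk, AddHom.coe_mk, Matrix.submatrix_apply]
    refine congrArg (fun N => Φ N y y') ?_
    ext u v
    simp only [Matrix.single_apply, Matrix.vecMulVec_apply, Matrix.of_apply, Pi.star_apply,
      e.apply_eq_iff_eq, ite_and, eq_comm (a := x), eq_comm (a := x')]
    split_ifs <;> simp
  obtain ⟨B, hB⟩ := exists_eq_conjTranspose_mul_self hC
  refine ⟨fun s => Matrix.of fun y x => star (B s (x, y)), ?_⟩
  refine Matrix.ext_linearMap ℂ fun x x' => LinearMap.ext_ring ?_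
  ext y y'
  have := congrFun (congrFun hB (x, y)) (x', y')
  change Φ (Matrix.single x x' 1) y y' = _ at this
  change Φ (Matrix.single x x' 1) y y' = krausMap _ (Matrix.single x x' 1) y y'
  rw [this, krausMap_apply]
  simp [Matrix.sum_apply, Matrix.mul_apply, Matrix.single_apply, ite_and]

theorem trace_krausMap [Fintype X] [Fintype Y] [Fintype ι] (K : ι → Matrix Y X ℂ)
    (M : Matrix X X ℂ) : (krausMap K M).trace = ((∑ s, (K s)ᴴ * K s) * M).trace := by
  rw [krausMap_apply, Matrix.trace_sum, Finset.sum_mul, Matrix.trace_sum]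
  refine Finset.sum_congr rfl fun s _ => ?_
  rw [Matrix.trace_mul_comm, Matrix.mul_assoc]

theorem isTracePreserving_krausMap [Fintype X] [DecidableEq X] [Fintype Y] [Fintype ι]
    {K : ι → Matrix Y X ℂ} : IsTracePreserving (krausMap K) ↔ ∑ s, (K s)ᴴ * K s = 1 := by
  constructor
  · intro h
    refine Matrix.ext_iff_trace_mul_right.2 fun M => ?_
    rw [← trace_krausMap, h M, one_mul]
  · intro h M
    rw [trace_krausMap, h, one_mul]

/-- A map with Kraus operators satisfying `∑ₛ Kₛ† Kₛ = 1`. -/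
def IsKrausChannel [Fintype X] [DecidableEq X] [Fintype Y] (Φ : Superop X Y) : Prop :=
  ∃ (ι : Type) (_ : Fintype ι) (K : ι → Matrix Y X ℂ), Φ = krausMap K ∧ ∑ s, (K s)ᴴ * K s = 1

theorem IsChannel.isKrausChannel [Fintype X] [DecidableEq X] [Fintype Y] {Φ : Superop X Y}
    (h : IsChannel Φ) : IsKrausChannel Φ := by
  obtain ⟨K, rfl⟩ := h.1.exists_kraus
  exact ⟨_, _, K, rfl, isTracePreserving_krausMap.1 h.2⟩

theorem IsKrausChannel.isTracePreserving [Fintype X] [DecidableEq X] [Fintype Y]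
    {Φ : Superop X Y} (h : IsKrausChannel Φ) : IsTracePreserving Φ := by
  obtain ⟨ι, _, K, rfl, hK⟩ := h
  exact isTracePreserving_krausMap.2 hK

theorem krausMap_comp [Fintype X] [Fintype Y] [Fintype ι] [Fintype κ]
    (K : ι → Matrix Z Y ℂ) (L : κ → Matrix Y X ℂ) :
    krausMap K ∘ₗ krausMap L = krausMap fun p : κ × ι => K p.2 * L p.1 := by
  refine LinearMap.ext fun M => ?_
  simp only [LinearMap.comp_apply, krausMap_apply, Fintype.sum_prod_type, Matrix.mul_sum,
    Matrix.sum_mul, Matrix.conjTranspose_mul, Matrix.mul_assoc]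
  exact Finset.sum_comm

theorem IsKrausChannel.comp [Fintype X] [DecidableEq X] [Fintype Y] [DecidableEq Y] [Fintype Z]
    {Φ : Superop Y Z} {Ψ : Superop X Y} (hΦ : IsKrausChannel Φ) (hΨ : IsKrausChannel Ψ) :
    IsKrausChannel (Φ ∘ₗ Ψ) := by
  obtain ⟨ι, _, K, rfl, hK⟩ := hΦ
  obtain ⟨κ, _, L, rfl, hL⟩ := hΨ
  refine ⟨_, _, _, krausMap_comp K L, ?_⟩
  have (t : κ) : ∑ s, (K s * L t)ᴴ * (K s * L t) = (L t)ᴴ * L t := by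
    simp only [Matrix.conjTranspose_mul, Matrix.mul_assoc]
    rw [← Matrix.mul_sum]
    simp only [← Matrix.mul_assoc (_ᴴ) _ (L t)]
    rw [← Matrix.sum_mul, hK, Matrix.one_mul]
  rw [Fintype.sum_prod_type, ← hL]
  exact Finset.sum_congr rfl fun t _ => this t

/-- The matrix permuting basis labels, with `relabel g = conjBy (labelMatrix g)`. -/
def labelMatrix [DecidableEq X] (g : Y → X) : Matrix Y X ℂ :=
  (1 : Matrix X X ℂ).submatrix g id

theorem labelMatrix_conjTranspose_mul_self [Fintype Y] [Fintype X] [DecidableEq X] {g : Y → X}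
    (hg : g.Bijective) : (labelMatrix g)ᴴ * labelMatrix g = 1 := by
  ext x x'
  simp only [labelMatrix, Matrix.mul_apply, Matrix.conjTranspose_apply, Matrix.submatrix_apply]
  rw [hg.sum_comp fun y => star ((1 : Matrix X X ℂ) y (id x)) * (1 : Matrix X X ℂ) y (id x')]
  simp [Matrix.one_apply, eq_comm]

theorem relabel_eq_conjBy [Fintype X] [DecidableEq X] (g : Y → X) :
    relabel g = conjBy (labelMatrix g) := by
  refine LinearMap.ext fun M => ?_
  ext y y'
  change M (g y) (g y') = (labelMatrix g * M * (labelMatrix g)ᴴ) y y'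
  simp [labelMatrix, Matrix.mul_apply, Matrix.one_apply]

theorem conjBy_eq_krausMap [Fintype X] (W : Matrix Y X ℂ) :
    conjBy W = krausMap fun _ : Unit => W := by
  simp [krausMap]

theorem isKrausChannel_relabel [Fintype X] [DecidableEq X] [Fintype Y] {g : Y → X}
    (hg : g.Bijective) : IsKrausChannel (relabel g) :=
  ⟨Unit, inferInstance, fun _ => labelMatrix g,
    (relabel_eq_conjBy g).trans (conjBy_eq_krausMap _),
    by simpa using labelMatrix_conjTranspose_mul_self hg⟩

end Kraus

/-! ### Tensor products of matrices over finite families -/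

section PiKronecker

variable {ι : Type} [Fintype ι] {X Y Z : ι → Type}

/-- The tensor product `⨂ᵢ Aᵢ` of a finite family of matrices. -/
def piKron (A : ∀ i, Matrix (Y i) (X i) ℂ) : Matrix (∀ i, Y i) (∀ i, X i) ℂ :=
  Matrix.of fun y x => ∏ i, A i (y i) (x i)

theorem piKron_mul [DecidableEq ι] [∀ i, Fintype (Y i)] (A : ∀ i, Matrix (Z i) (Y i) ℂ)
    (B : ∀ i, Matrix (Y i) (X i) ℂ) :
    piKron A * piKron B = piKron fun i => A i * B i := by
  ext z x
  simp [piKron, Matrix.mul_apply, Finset.prod_univ_sum, Fintype.piFinset_univ,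
    Finset.prod_mul_distrib]

theorem piKron_conjTranspose (A : ∀ i, Matrix (Y i) (X i) ℂ) :
    (piKron A)ᴴ = piKron fun i => (A i)ᴴ := by
  ext x y
  simp [piKron, Matrix.conjTranspose_apply]

theorem piKron_one [DecidableEq ι] [∀ i, DecidableEq (X i)] :
    piKron (fun i => (1 : Matrix (X i) (X i) ℂ)) = 1 := by
  ext x x'
  simp [piKron, Matrix.one_apply, Finset.prod_ite_zero, funext_iff]

theorem sum_piKron [DecidableEq ι] {κ : ι → Type} [∀ i, Fintype (κ i)]
    (A : ∀ i, κ i → Matrix (Y i) (X i) ℂ) :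
    ∑ t : ∀ i, κ i, piKron (fun i => A i (t i)) = piKron fun i => ∑ s, A i s := by
  ext y x
  simp [piKron, Matrix.sum_apply, Finset.prod_univ_sum, Fintype.piFinset_univ]

theorem trace_piKron [DecidableEq ι] [∀ i, Fintype (X i)] (A : ∀ i, Matrix (X i) (X i) ℂ) :
    (piKron A).trace = ∏ i, (A i).trace := by
  simp [Matrix.trace, piKron, Finset.prod_univ_sum, Fintype.piFinset_univ]

theorem posSemidef_piKron [DecidableEq ι] [∀ i, Fintype (X i)] {P : ∀ i, Matrix (X i) (X i) ℂ}
    (h : ∀ i, (P i).PosSemidef) : (piKron P).PosSemidef := by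
  classical
  choose B hB using fun i => exists_eq_conjTranspose_mul_self (h i)
  have : piKron P = (piKron B)ᴴ * piKron B := by
    rw [piKron_conjTranspose, piKron_mul]
    exact congrArg piKron (funext hB)
  rw [this]
  exact Matrix.posSemidef_conjTranspose_mul_self _

theorem isPartialIsometry_piKron [DecidableEq ι] [∀ i, Fintype (X i)] [∀ i, Fintype (Y i)]
    {W : ∀ i, Matrix (Y i) (X i) ℂ} (h : ∀ i, IsPartialIsometry (W i)) :
    IsPartialIsometry (piKron W) := by
  rw [IsPartialIsometry, piKron_conjTranspose, piKron_mul, piKron_mul]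
  exact congrArg piKron (funext h)

theorem tensorMap_krausMap [DecidableEq ι] [∀ i, Fintype (X i)] [∀ i, DecidableEq (X i)]
    {κ : ι → Type} [∀ i, Fintype (κ i)] (K : ∀ i, κ i → Matrix (Y i) (X i) ℂ) :
    tensorMap (fun i => krausMap (K i)) =
      krausMap fun t : ∀ i, κ i => piKron fun i => K i (t i) := by
  refine LinearMap.ext fun M => ?_
  ext y y'
  have h (x x' : ∀ i, X i) (i : ι) :
      krausMap (K i) (Matrix.single (x i) (x' i) 1) (y i) (y' i) =
        ∑ s, K i s (y i) (x i) * star (K i s (y' i) (x' i)) := by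
    simp [krausMap_apply, Matrix.sum_apply, Matrix.mul_apply, Matrix.single_apply, ite_and,
      Finset.sum_ite_eq]
  have hl : tensorMap (fun i => krausMap (K i)) M y y' = ∑ x, ∑ x', M x x' * ∏ i,
      krausMap (K i) (Matrix.single (x i) (x' i) 1) (y i) (y' i) := rfl
  have hr : krausMap (fun t : ∀ i, κ i => piKron fun i => K i (t i)) M y y' =
      ∑ t : ∀ i, κ i, ∑ x', ∑ x, (∏ i, K i (t i) (y i) (x i)) * M x x' *
        star (∏ i, K i (t i) (y' i) (x' i)) := by
    simp [krausMap_apply, Matrix.sum_apply, Matrix.mul_apply, piKron, Finset.sum_mul]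
  rw [hl, hr, Finset.sum_comm, Finset.sum_comm (s := (Finset.univ : Finset (∀ i, κ i)))]
  refine Finset.sum_congr rfl fun x' _ => ?_
  rw [Finset.sum_comm (s := (Finset.univ : Finset (∀ i, κ i)))]
  refine Finset.sum_congr rfl fun x _ => ?_
  simp only [h, Finset.prod_univ_sum, Fintype.piFinset_univ, Finset.mul_sum,
    Finset.prod_mul_distrib, star_prod]
  refine Finset.sum_congr rfl fun t _ => ?_
  ring

theorem isKrausChannel_tensorMap [DecidableEq ι] [∀ i, Fintype (X i)] [∀ i, DecidableEq (X i)]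
    [∀ i, Fintype (Y i)] {Φ : ∀ i, Superop (X i) (Y i)} (h : ∀ i, IsKrausChannel (Φ i)) :
    IsKrausChannel (tensorMap Φ) := by
  choose κ hκ K hΦ hK using h
  obtain rfl : Φ = fun i => krausMap (K i) := funext hΦ
  refine ⟨_, _, _, tensorMap_krausMap K, ?_⟩
  simp only [piKron_conjTranspose, piKron_mul]
  rw [sum_piKron fun i s => (K i s)ᴴ * K i s]
  simp only [hK, piKron_one]

end PiKronecker

/-! ### Polar decomposition -/

section Polar

variable {X Y : Type} [Fintype X] [Fintype Y]

/-- Polar decomposition of a rectangular matrix. The last equation says that `W† W` acts as the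
identity on the range of `P`. -/
theorem exists_polar (M : Matrix Y X ℂ) :
    ∃ (W : Matrix Y X ℂ) (P : Matrix X X ℂ),
      IsPartialIsometry W ∧ P.PosSemidef ∧ M = W * P ∧ Wᴴ * M = P := by
  classical
  have hH : (Mᴴ * M).PosSemidef := Matrix.posSemidef_conjTranspose_mul_self M
  let U : Matrix X X ℂ := hH.1.eigenvectorUnitary
  let ev := hH.1.eigenvalues
  have h0 (x : X) : 0 ≤ ev x := hH.eigenvalues_nonneg x
  have hU : Uᴴ * U = 1 := Matrix.mem_unitaryGroup_iff'.1 hH.1.eigenvectorUnitary.2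
  have hspec : Mᴴ * M = U * Matrix.diagonal (fun x => (ev x : ℂ)) * Uᴴ := by
    conv_lhs => rw [hH.1.spectral_theorem]
    rfl
  -- Functions of `M† M`; they multiply pointwise.
  let F : (X → ℝ) → Matrix X X ℂ := fun f => U * Matrix.diagonal (fun x => (f x : ℂ)) * Uᴴ
  have hF (f g : X → ℝ) : F f * F g = F (fun x => f x * g x) := by
    have : F f * F g = U * (Matrix.diagonal (fun x => (f x : ℂ)) * (Uᴴ * U) *
        Matrix.diagonal (fun x => (g x : ℂ))) * Uᴴ := by
      simp only [F, Matrix.mul_assoc]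
    rw [this, hU, mul_one, Matrix.diagonal_mul_diagonal]
    simp [F]
  have hFH (f : X → ℝ) : (F f)ᴴ = F f := by
    simp only [F, Matrix.conjTranspose_mul, Matrix.conjTranspose_conjTranspose,
      Matrix.diagonal_conjTranspose, Matrix.mul_assoc]
    congr 3
    ext x
    simp
  have hMM : Mᴴ * M = F ev := hspec
  let q : X → ℝ := fun x => √(ev x)
  -- The witness is `W = M q⁻¹(M† M)`; since `0⁻¹ = 0`, it vanishes on the kernel of `M`.
  have hq (x : X) : ev x = q x * q x := (Real.mul_self_sqrt (h0 x)).symm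
  have hW : (M * F fun x => (q x)⁻¹)ᴴ * M = F q := by
    rw [Matrix.conjTranspose_mul, hFH, Matrix.mul_assoc, hMM, hF]
    congr 1
    funext x
    rw [hq, ← mul_assoc, inv_mul_mul_self]
  -- The difference `D` of the two sides vanishes because `D† D = 0`.
  have hWP : M = (M * F fun x => (q x)⁻¹) * F q := by
    rw [Matrix.mul_assoc, hF, ← sub_eq_zero]
    refine Matrix.conjTranspose_mul_self_eq_zero.1 ?_
    simp only [Matrix.conjTranspose_sub, Matrix.conjTranspose_mul, hFH, Matrix.sub_mul,
      Matrix.mul_sub, Matrix.mul_assoc, hMM]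
    simp only [← Matrix.mul_assoc Mᴴ M, hMM, hF]
    have h1 (x : X) : ev x * ((q x)⁻¹ * q x) = ev x := by
      rw [hq, mul_assoc, ← mul_assoc (q x) (q x)⁻¹, mul_inv_mul_cancel]
    have h2 (x : X) : (q x)⁻¹ * q x * ev x = ev x := by rw [mul_comm, h1]
    simp only [h1, h2, sub_self]
  refine ⟨M * F fun x => (q x)⁻¹, F q, ?_, ?_, hWP, hW⟩
  · rw [IsPartialIsometry, Matrix.mul_assoc, ← Matrix.mul_assoc (_ᴴ) M, hW, hF, Matrix.mul_assoc,
      hF]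
    refine congrArg (fun f => M * F f) (funext fun x => ?_)
    by_cases h : q x = 0 <;> simp [h]
  · have : F q = F (fun x => √(q x)) * (F (fun x => √(q x)))ᴴ := by
      rw [hFH, hF]
      congr 1
      funext x
      exact (Real.mul_self_sqrt (Real.sqrt_nonneg _)).symm
    rw [this]
    exact Matrix.posSemidef_self_mul_conjTranspose _

end Polar

/-! ### Entanglement fidelity in terms of the reduced state -/

section Fidelity

variable {R X Y Z ι : Type} [Fintype X]

theorem posSemidef_reduced [Fintype R] (ψ : R × X → ℂ) : (reduced ψ).PosSemidef := by
  have : reduced ψ =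
      (Matrix.of fun x r => ψ (r, x)) * (Matrix.of fun (x : X) (r : R) => ψ (r, x))ᴴ := by
    ext x x'
    simp [reduced, Matrix.mul_apply]
  rw [this]
  exact Matrix.posSemidef_self_mul_conjTranspose _

theorem trace_reduced [Fintype R] (ψ : R × X → ℂ) :
    (reduced ψ).trace = ((∑ z, ‖ψ z‖ ^ 2 : ℝ) : ℂ) := by
  rw [Fintype.sum_prod_type, Finset.sum_comm]
  simp [reduced, Matrix.trace, Complex.mul_conj, Complex.normSq_eq_norm_sq]

/-- Purification enters the entanglement fidelity only through the reduced state. -/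
theorem entanglementFidelity_krausMap [Fintype R] [Fintype ι] (ψ : R × X → ℂ)
    (K : ι → Matrix X X ℂ) :
    entanglementFidelity ψ (krausMap K) = ∑ s, ‖(K s * reduced ψ).trace‖ ^ 2 := by
  have key (K : Matrix X X ℂ) : star ψ ⬝ᵥ
      (ampl R (conjBy K) (Matrix.vecMulVec ψ (star ψ)) *ᵥ ψ) =
        ((‖(K * reduced ψ).trace‖ ^ 2 : ℝ) : ℂ) := by
    let φ : R × X → ℂ := fun p => ∑ x, K p.2 x * ψ (p.1, x)
    have h1 : ampl R (conjBy K) (Matrix.vecMulVec ψ (star ψ)) = Matrix.vecMulVec φ (star φ) := by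
      ext ⟨r, y⟩ ⟨r', y'⟩
      simp only [ampl, conjBy, LinearMap.coe_mk, AddHom.coe_mk, Matrix.of_apply, Matrix.mul_apply,
        Matrix.vecMulVec_apply, Pi.star_apply, φ, star_sum, star_mul', Finset.sum_mul,
        Finset.mul_sum, Matrix.conjTranspose_apply]
      refine Finset.sum_congr rfl fun x _ => Finset.sum_congr rfl fun x' _ => ?_
      ring
    have h2 : star ψ ⬝ᵥ φ = (K * reduced ψ).trace := by
      simp only [dotProduct, φ, Fintype.sum_prod_type, Matrix.trace, Matrix.diag, Matrix.mul_apply,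
        reduced, Matrix.of_apply, Finset.mul_sum, Pi.star_apply]
      rw [Finset.sum_comm]
      refine Finset.sum_congr rfl fun x _ => ?_
      rw [Finset.sum_comm]
      refine Finset.sum_congr rfl fun x' _ => Finset.sum_congr rfl fun r _ => ?_
      ring
    have h3 : star φ ⬝ᵥ ψ = star (star ψ ⬝ᵥ φ) := by
      rw [Matrix.star_dotProduct]
    rw [h1, Matrix.vecMulVec_mulVec, dotProduct_smul, h3, h2]
    simp [Complex.mul_conj']
  simp only [entanglementFidelity, krausMap, ampl_sum, Matrix.sum_mulVec, dotProduct_sum, key,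
    Complex.re_sum, Complex.ofReal_re]

end Fidelity

/-! ### Replacing an encoding by the partial isometry of a polar decomposition -/

section Rounding

variable {X Y ι : Type} [Fintype X] [Fintype Y] [Fintype ι]

theorem trace_conj_re_nonneg {ρ : Matrix X X ℂ} (hρ : ρ.PosSemidef) (A : Matrix Y X ℂ) :
    0 ≤ (A * ρ * Aᴴ).trace.re :=
  (Complex.nonneg_iff.1 (hρ.mul_mul_conjTranspose_same A).trace_nonneg).1

theorem norm_trace_conjTranspose_mul_sq_le (U V : Matrix Y X ℂ) :
    ‖(Uᴴ * V).trace‖ ^ 2 ≤ (Uᴴ * U).trace.re * (Vᴴ * V).trace.re := by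
  have h (A B : Matrix Y X ℂ) : (Aᴴ * B).trace =
      inner ℂ (WithLp.toLp 2 fun p : X × Y => A p.2 p.1)
        (WithLp.toLp 2 fun p : X × Y => B p.2 p.1) := by
    simp [PiLp.inner_apply, Matrix.trace, Matrix.mul_apply, Fintype.sum_prod_type, mul_comm]
  rw [h, h, h, sq]
  have := inner_mul_inner_self_le (𝕜 := ℂ) (WithLp.toLp 2 fun p : X × Y => U p.2 p.1)
    (WithLp.toLp 2 fun p : X × Y => V p.2 p.1)
  rwa [norm_inner_symm (𝕜 := ℂ) (WithLp.toLp 2 fun p : X × Y => V p.2 p.1)] at this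

/-- The Cauchy–Schwarz bound for a channel with Kraus operators `Tₛ` after an encoding `A`. -/
theorem sum_norm_trace_sq_le {T : ι → Matrix X Y ℂ} [DecidableEq Y] (hT : ∑ s, (T s)ᴴ * T s = 1)
    {ρ : Matrix X X ℂ} (hρ : ρ.PosSemidef) (A : Matrix Y X ℂ) :
    ∑ s, ‖(T s * A * ρ).trace‖ ^ 2 ≤ ρ.trace.re * (A * ρ * Aᴴ).trace.re := by
  obtain ⟨B, rfl⟩ := exists_eq_conjTranspose_mul_self hρ
  have h (s : ι) : ‖(T s * A * (Bᴴ * B)).trace‖ ^ 2 ≤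
      (Bᴴ * B).trace.re * (B * Aᴴ * ((T s)ᴴ * T s) * (A * Bᴴ)).trace.re := by
    have h1 : (T s * A * (Bᴴ * B)).trace = (Bᴴᴴ * (T s * A * Bᴴ)).trace := by
      rw [Matrix.conjTranspose_conjTranspose, ← Matrix.mul_assoc, Matrix.trace_mul_comm]
    rw [h1]
    refine (norm_trace_conjTranspose_mul_sq_le _ _).trans_eq ?_
    rw [Matrix.conjTranspose_conjTranspose, Matrix.trace_mul_comm B]
    simp only [Matrix.conjTranspose_mul, Matrix.conjTranspose_conjTranspose, Matrix.mul_assoc]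
  refine (Finset.sum_le_sum fun s _ => h s).trans_eq ?_
  rw [← Finset.mul_sum, ← Complex.re_sum, ← Matrix.trace_sum, ← Matrix.sum_mul, ← Matrix.mul_sum,
    hT, Matrix.mul_one, Matrix.trace_mul_comm (B * Aᴴ)]
  simp only [Matrix.mul_assoc]

theorem IsPartialIsometry.conjTranspose_mul_self_compl [DecidableEq X] {W : Matrix Y X ℂ}
    (hW : IsPartialIsometry W) : (1 - Wᴴ * W)ᴴ * (1 - Wᴴ * W) = 1 - Wᴴ * W := by
  have h : Wᴴ * W * (Wᴴ * W) = Wᴴ * W := by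
    rw [Matrix.mul_assoc, ← Matrix.mul_assoc W, hW]
  simp [Matrix.mul_sub, Matrix.sub_mul, h]

theorem IsPartialIsometry.trace_conj_le {W : Matrix Y X ℂ} (hW : IsPartialIsometry W)
    {ρ : Matrix X X ℂ} (hρ : ρ.PosSemidef) : (W * ρ * Wᴴ).trace.re ≤ ρ.trace.re := by
  classical
  have h := trace_conj_re_nonneg hρ (1 - Wᴴ * W)
  have h1 : ((1 - Wᴴ * W) * ρ * (1 - Wᴴ * W)ᴴ).trace = ρ.trace - (W * ρ * Wᴴ).trace := by
    rw [Matrix.trace_mul_comm, ← Matrix.mul_assoc, hW.conjTranspose_mul_self_compl, Matrix.sub_mul, Matrix.trace_sub, Matrix.one_mul, Matrix.trace_mul_comm (W * ρ),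
      Matrix.mul_assoc]
  rw [h1, Complex.sub_re] at h
  linarith

theorem sum_norm_trace_sq_le_one {T : ι → Matrix X Y ℂ} [DecidableEq Y]
    (hT : ∑ s, (T s)ᴴ * T s = 1) {ρ : Matrix X X ℂ} (hρ : ρ.PosSemidef) (h1 : ρ.trace = 1)
    {W : Matrix Y X ℂ} (hW : IsPartialIsometry W) :
    ∑ s, ‖(T s * W * ρ).trace‖ ^ 2 ≤ 1 := by
  have := sum_norm_trace_sq_le hT hρ W
  have h2 := hW.trace_conj_le hρ
  rw [h1] at this h2
  simpa using this.trans (mul_le_mul_of_nonneg_left h2 zero_le_one)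

/-- If the encoding `A` is decoded with fidelity at least `p F`, where `p = tr A ρ A†` is its
probability, then the partial isometry `W` from the polar decomposition of `A ρ` is decoded well:
decodability forces `tr W† A ρ = ‖A ρ‖₁` to be almost maximal, so `√p W` and `A` are close in the
Hilbert–Schmidt norm weighted by `ρ`. -/
theorem sqrt_fidelity_polar_ge {T : ι → Matrix X Y ℂ} [DecidableEq Y]
    (hT : ∑ s, (T s)ᴴ * T s = 1) {ρ : Matrix X X ℂ} (hρ : ρ.PosSemidef) (h1 : ρ.trace = 1)
    {A W : Matrix Y X ℂ} {P : Matrix X X ℂ} (hW : IsPartialIsometry W) (hP : P.PosSemidef)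
    (hWP : A * ρ = W * P) (hPW : Wᴴ * (A * ρ) = P) {F : ℝ}
    (hp : 0 < (A * ρ * Aᴴ).trace.re)
    (hF : F * (A * ρ * Aᴴ).trace.re ≤ ∑ s, ‖(T s * A * ρ).trace‖ ^ 2) :
    √F - √(2 * (1 - √F)) ≤ √(∑ s, ‖(T s * W * ρ).trace‖ ^ 2) := by
  set p := (A * ρ * Aᴴ).trace.re with hpdef
  have hp' : 0 < √p := Real.sqrt_pos.2 hp
  have hpp : √p * √p = p := Real.mul_self_sqrt hp.le
  let v : Matrix Y X ℂ → EuclideanSpace ℂ ι := fun C => WithLp.toLp 2 fun s => (T s * C * ρ).trace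
  have hv (C : Matrix Y X ℂ) : ‖v C‖ = √(∑ s, ‖(T s * C * ρ).trace‖ ^ 2) :=
    EuclideanSpace.norm_eq _
  let c : ℂ := ((√p : ℝ) : ℂ)
  let Δ := c • W - A
  have hvΔ : v Δ = c • v W - v A := by
    ext s
    simp [v, Δ, Matrix.mul_sub, Matrix.sub_mul]
  have hPt : 0 ≤ P.trace.re := (Complex.nonneg_iff.1 hP.trace_nonneg).1
  have hPim : P.trace.im = 0 := (Complex.nonneg_iff.1 hP.trace_nonneg).2.symm
  -- The trace norm of `A ρ` bounds the decoding amplitude from above.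
  have hP2 : √p * √F ≤ P.trace.re := by
    rw [← Real.sqrt_mul hp.le, mul_comm]
    refine Real.sqrt_le_iff.2 ⟨hPt, hF.trans ?_⟩
    have h := sum_norm_trace_sq_le hT hP W
    simp only [Matrix.mul_assoc] at h ⊢
    simp only [hWP]
    refine h.trans ?_
    rw [sq, ← Matrix.mul_assoc]
    exact mul_le_mul_of_nonneg_left (hW.trace_conj_le hP) hPt
  have hΔ : (Δ * ρ * Δᴴ).trace.re ≤ p * (2 * (1 - √F)) := by
    have e1 : (A * ρ * Wᴴ).trace = P.trace := by rw [Matrix.trace_mul_comm, hPW]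
    have e2 : (W * ρ * Aᴴ).trace = star P.trace := by
      rw [← e1, ← Matrix.trace_conjTranspose]
      simp only [Matrix.conjTranspose_mul, Matrix.conjTranspose_conjTranspose, hρ.1.eq,
        Matrix.mul_assoc]
    have e3 : (Δ * ρ * Δᴴ).trace.re = p * (W * ρ * Wᴴ).trace.re - 2 * √p * P.trace.re + p := by
      have : (Δ * ρ * Δᴴ).trace = c * c * (W * ρ * Wᴴ).trace - c * (W * ρ * Aᴴ).trace
          - c * (A * ρ * Wᴴ).trace + (A * ρ * Aᴴ).trace := by
        simp only [Δ, Matrix.conjTranspose_sub, Matrix.conjTranspose_smul, Matrix.sub_mul,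
          Matrix.mul_sub, Matrix.smul_mul, Matrix.mul_smul, Matrix.trace_sub, Matrix.trace_smul,
          smul_eq_mul, c, Complex.star_def, Complex.conj_ofReal]
        ring
      rw [this, e1, e2]
      simp only [c, Complex.add_re, Complex.sub_re, Complex.mul_re, Complex.mul_im,
        Complex.ofReal_re, Complex.ofReal_im, Complex.star_def, Complex.conj_re, ← hpdef]
      linear_combination (W * ρ * Wᴴ).trace.re * hpp
    have e4 := hW.trace_conj_le hρ
    rw [h1, Complex.one_re] at e4
    rw [e3]
    nlinarith [mul_le_mul_of_nonneg_left e4 hp.le, mul_le_mul_of_nonneg_left hP2 hp'.le]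
  have hΔ2 : ‖v Δ‖ ≤ √p * √(2 * (1 - √F)) := by
    rw [← Real.sqrt_mul hp.le, hv]
    refine Real.sqrt_le_sqrt (((sum_norm_trace_sq_le hT hρ Δ)).trans ?_)
    rw [h1]
    simpa using hΔ
  have hA : √p * √F ≤ ‖v A‖ := by
    rw [← Real.sqrt_mul hp.le, hv, mul_comm]
    exact Real.sqrt_le_sqrt hF
  have htri : ‖v A‖ ≤ √p * ‖v W‖ + ‖v Δ‖ := by
    have : v A = c • v W - v Δ := by rw [hvΔ]; abel
    rw [this]
    refine (norm_sub_le _ _).trans_eq ?_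
    rw [norm_smul]
    simp [c, abs_of_pos hp']
  rw [← hv]
  refine le_of_mul_le_mul_left ?_ hp'
  linarith

end Rounding

/-- A convex combination has a member at least as good as the average. -/
theorem exists_pos_mul_sum_le {Θ : Type} [Fintype Θ] {p f : Θ → ℝ} (h0 : ∀ t, 0 ≤ f t)
    (hfp : ∀ t, f t ≤ p t) (hp : ∑ t, p t = 1) : ∃ t, 0 < p t ∧ (∑ t, f t) * p t ≤ f t := by
  by_contra! h
  obtain ⟨t, -, ht⟩ : ∃ t ∈ Finset.univ, 0 < p t := by
    refine Finset.exists_lt_of_sum_lt (f := fun _ => (0 : ℝ)) ?_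
    simp [hp]
  have : ∑ t, f t < ∑ u, (∑ t, f t) * p u := by
    refine Finset.sum_lt_sum (fun u _ => ?_) ⟨t, Finset.mem_univ _, h t ht⟩
    rcases ((h0 u).trans (hfp u)).eq_or_lt with h1 | h1
    · rw [← h1, mul_zero, h1]
      exact hfp u
    · exact (h u h1).le
  rw [← Finset.mul_sum, hp, mul_one] at this
  exact this.false

/-! ### The network -/

theorem entanglementFidelity_sum {R X α : Type} [Fintype R] [Fintype X] (ψ : R × X → ℂ)
    (t : Finset α) (Φ : α → Superop X X) :
    entanglementFidelity ψ (∑ i ∈ t, Φ i) = ∑ i ∈ t, entanglementFidelity ψ (Φ i) := by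
  simp only [entanglementFidelity, ampl_sum, Matrix.sum_mulVec, dotProduct_sum, Complex.re_sum]

theorem IsKrausChannel.entanglementFidelity_le_one {R X : Type} [Fintype R] [Fintype X]
    [DecidableEq X] {ψ : R × X → ℂ} (hψ : (reduced ψ).trace = 1) {Φ : Superop X X}
    (h : IsKrausChannel Φ) : entanglementFidelity ψ Φ ≤ 1 := by
  obtain ⟨ι, _, K, rfl, hK⟩ := h
  rw [entanglementFidelity_krausMap]
  have := sum_norm_trace_sq_le_one hK (posSemidef_reduced ψ) hψ (W := 1)
    (by simp [IsPartialIsometry])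
  simpa using this

/-- A partial isometry is one branch of a channel: on the complement of its initial space a fixed
basis state is prepared. -/
theorem IsPartialIsometry.exists_kraus_option {X Y : Type} [Fintype X] [DecidableEq X] [Fintype Y]
    [Nonempty Y] {W : Matrix Y X ℂ} (hW : IsPartialIsometry W) :
    ∃ K : Option X → Matrix Y X ℂ, K none = W ∧ ∑ s, (K s)ᴴ * K s = 1 := by
  classical
  obtain ⟨y₀⟩ := ‹Nonempty Y›
  let e : X → Matrix Y X ℂ := fun x => Matrix.single y₀ x 1
  have he : ∑ x, (e x)ᴴ * e x = 1 := by
    ext x x'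
    simp [e, Matrix.sum_apply, Matrix.single_apply, Matrix.one_apply, ite_and]
  refine ⟨fun o => o.elim W fun x => e x * (1 - Wᴴ * W), rfl, ?_⟩
  rw [Fintype.sum_option]
  change Wᴴ * W + ∑ x, (e x * (1 - Wᴴ * W))ᴴ * (e x * (1 - Wᴴ * W)) = 1
  have h : ∑ x, (e x * (1 - Wᴴ * W))ᴴ * (e x * (1 - Wᴴ * W)) =
      (1 - Wᴴ * W)ᴴ * (∑ x, (e x)ᴴ * e x) * (1 - Wᴴ * W) := by
    simp only [Matrix.mul_sum, Matrix.sum_mul, Matrix.conjTranspose_mul, Matrix.mul_assoc]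
  rw [h, he, Matrix.mul_one, hW.conjTranspose_mul_self_compl, add_sub_cancel]

section Network

variable {k m : ℕ} {a : Fin k → ℕ} {b : Fin m → ℕ} {l : Fin k → ℕ} {dst : Flow l → Fin m}
  {d : Flow l → ℕ} {n : ℕ}

/-- The joint state of the subsystems held by sender `i`. -/
def BlockSource.senderState (s : BlockSource l d n) (i : Fin k) :
    Matrix (SenderSpace l d n i) (SenderSpace l d n i) ℂ :=
  piKron fun α => reduced (s.psi ⟨i, α⟩)

theorem BlockSource.reduced_total (s : BlockSource l d n) :
    reduced s.total = piKron fun f => reduced (s.psi f) := by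
  ext x x'
  simp only [reduced, BlockSource.total, piKron, Matrix.of_apply, Finset.prod_univ_sum,
    Fintype.piFinset_univ, star_prod, Finset.prod_mul_distrib]

theorem BlockSource.trace_reduced_psi (s : BlockSource l d n) (f : Flow l) :
    (reduced (s.psi f)).trace = 1 := by
  rw [trace_reduced, s.unit, Complex.ofReal_one]

theorem BlockSource.trace_reduced_total (s : BlockSource l d n) :
    (reduced s.total).trace = 1 := by
  rw [s.reduced_total, trace_piKron]
  exact Finset.prod_eq_one fun f _ => s.trace_reduced_psi f

theorem BlockSource.posSemidef_senderStates (s : BlockSource l d n) :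
    (piKron s.senderState).PosSemidef :=
  posSemidef_piKron fun _ => posSemidef_piKron fun _ => posSemidef_reduced _

theorem BlockSource.trace_senderStates (s : BlockSource l d n) :
    (piKron s.senderState).trace = 1 := by
  rw [trace_piKron]
  refine Finset.prod_eq_one fun i _ => ?_
  rw [BlockSource.senderState, trace_piKron]
  exact Finset.prod_eq_one fun α _ => s.trace_reduced_psi _

/-- Grouping the subsystems by sender. -/
def bySender (l : Fin k → ℕ) (d : Flow l → ℕ) (n : ℕ) (g : ∀ i, SenderSpace l d n i) :
    TotalSpace l d n :=
  fun f => g f.1 f.2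

theorem bijective_bySender : (bySender l d n).Bijective :=
  Function.bijective_iff_has_inverse.2 ⟨fun h i α => h ⟨i, α⟩, fun _ => rfl, fun _ => rfl⟩

theorem BlockSource.relabel_reduced_total (s : BlockSource l d n) :
    relabel (bySender l d n) (reduced s.total) = piKron s.senderState := by
  rw [s.reduced_total]
  ext g g'
  exact Fintype.prod_sigma _

/-- Everything that follows the encoding: the network and the decoders. -/
def transmit (Λ : Superop (ChIn a) (ChOut b)) (D : Decoders b l dst d n) :
    Superop (∀ i, Blk (a i) n) (TotalSpace l d n) :=
  relabel (fun (g : TotalSpace l d n) (r : Fin m) (f : {f : Flow l // dst f = r}) => g f.1) ∘ₗ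
  tensorMap D ∘ₗ
  relabel (fun (y : ∀ r, Blk (b r) n) (t : Fin n) (r : Fin m) => y r t) ∘ₗ
  tensorPow Λ n ∘ₗ
  relabel (fun (x : Fin n → ChIn a) (i : Fin k) (t : Fin n) => x t i)

theorem endToEnd_eq (Λ : Superop (ChIn a) (ChOut b)) (E : Encoders a l d n)
    (D : Decoders b l dst d n) :
    endToEnd Λ E D = transmit Λ D ∘ₗ tensorMap E ∘ₗ relabel (bySender l d n) :=
  rfl

theorem isKrausChannel_transmit {Λ : Superop (ChIn a) (ChOut b)} (hΛ : IsChannel Λ)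
    {D : Decoders b l dst d n} (hD : ∀ r, IsChannel (D r)) : IsKrausChannel (transmit Λ D) := by
  refine (isKrausChannel_relabel ?_).comp <|
    (isKrausChannel_tensorMap fun r => (hD r).isKrausChannel).comp <|
    (isKrausChannel_relabel ?_).comp <|
    (isKrausChannel_tensorMap fun _ => hΛ.isKrausChannel).comp <| isKrausChannel_relabel ?_
  · refine Function.bijective_iff_has_inverse.2
      ⟨fun h f => h (dst f) ⟨f, rfl⟩, fun _ => rfl, fun h => ?_⟩
    funext r ⟨f, hf⟩
    subst hf
    rfl
  · exact Function.bijective_iff_has_inverse.2 ⟨fun h r t => h t r, fun _ => rfl, fun _ => rfl⟩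
  · exact Function.bijective_iff_has_inverse.2 ⟨fun h r t => h t r, fun _ => rfl, fun _ => rfl⟩

/-- For local encodings in Kraus form, the fidelity is a sum over the product branches of the
encoding, with Kraus operators of the transmission that depend on the decoders only. -/
theorem exists_fidelity_formula {Λ : Superop (ChIn a) (ChOut b)} (hΛ : IsChannel Λ)
    (s : BlockSource l d n) {D : Decoders b l dst d n} (hD : ∀ r, IsChannel (D r)) :
    ∃ (ι : Type) (_ : Fintype ι)
      (T : ι → Matrix (∀ i, SenderSpace l d n i) (∀ i, Blk (a i) n) ℂ),
      ∑ q, (T q)ᴴ * T q = 1 ∧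
      ∀ (κ : Fin k → Type) [∀ i, Fintype (κ i)]
        (A : ∀ i, κ i → Matrix (Blk (a i) n) (SenderSpace l d n i) ℂ),
        entanglementFidelity s.total (endToEnd Λ (fun i => krausMap (A i)) D) =
          ∑ t : ∀ i, κ i, ∑ q, ‖(T q * piKron (fun i => A i (t i)) *
            piKron s.senderState).trace‖ ^ 2 := by
  obtain ⟨ι, hι, K, hK, hK1⟩ := isKrausChannel_transmit hΛ hD
  let G := labelMatrix (bySender l d n)
  have hG : Gᴴ * G = 1 := labelMatrix_conjTranspose_mul_self bijective_bySender
  have hρ : piKron s.senderState = G * reduced s.total * Gᴴ := by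
    rw [← s.relabel_reduced_total, relabel_eq_conjBy]
    rfl
  refine ⟨ι, hι, fun q => G * K q, ?_, fun κ _ A => ?_⟩
  · rw [← hK1]
    refine Finset.sum_congr rfl fun q _ => ?_
    rw [Matrix.conjTranspose_mul, Matrix.mul_assoc, ← Matrix.mul_assoc _ G, hG, Matrix.one_mul]
  · rw [endToEnd_eq, hK, tensorMap_krausMap, relabel_eq_conjBy, conjBy_eq_krausMap, krausMap_comp,
      krausMap_comp, entanglementFidelity_krausMap]
    simp only [Fintype.sum_prod_type, Fintype.sum_unique]
    refine Finset.sum_congr rfl fun t _ => Finset.sum_congr rfl fun q _ => ?_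
    have hGρ : G * reduced s.total = piKron s.senderState * G := by
      rw [hρ, Matrix.mul_assoc _ _ G, hG, Matrix.mul_one]
    have (B : Matrix (TotalSpace l d n) (∀ i, SenderSpace l d n i) ℂ) :
        (B * G * reduced s.total).trace = (G * B * piKron s.senderState).trace := by
      rw [Matrix.mul_assoc, hGρ, ← Matrix.mul_assoc, Matrix.trace_mul_comm, Matrix.mul_assoc]
    have := this (K q * piKron fun i => A i (t i))
    simp only [Matrix.mul_assoc] at this ⊢
    rw [← this]

theorem isKrausChannel_endToEnd {Λ : Superop (ChIn a) (ChOut b)} (hΛ : IsChannel Λ)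
    {E : Encoders a l d n} (hE : ∀ i, IsChannel (E i)) {D : Decoders b l dst d n}
    (hD : ∀ r, IsChannel (D r)) : IsKrausChannel (endToEnd Λ E D) :=
  (isKrausChannel_transmit hΛ hD).comp <|
    (isKrausChannel_tensorMap fun i => (hE i).isKrausChannel).comp <|
      isKrausChannel_relabel bijective_bySender

/-- Forward classical communication can be removed from a single block code at the price of a
controlled loss of fidelity. -/
theorem ForwardCode.exists_zeroWayCode {Λ : Superop (ChIn a) (ChOut b)} (hΛ : IsChannel Λ)
    (s : BlockSource l d n) (P : ForwardCode a b l dst d n) :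
    ∃ (j : Fin P.numMsg) (Q : ZeroWayCode a b l dst d n)
      (W : ∀ i, Matrix (Blk (a i) n) (SenderSpace l d n i) ℂ),
      Q.dec = P.dec j ∧
      (∀ i, IsPartialIsometry (W i) ∧ IsCompletelyPositive (Q.enc i - conjBy (W i))) ∧
      √(entanglementFidelity s.total (P.effective Λ)) -
          √(2 * (1 - √(entanglementFidelity s.total (P.effective Λ)))) ≤
        √(entanglementFidelity s.total (endToEnd Λ (fun i => conjBy (W i)) (P.dec j))) ∧
      0 ≤ entanglementFidelity s.total (endToEnd Λ (fun i => conjBy (W i)) (P.dec j)) ∧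
      entanglementFidelity s.total (endToEnd Λ (fun i => conjBy (W i)) (P.dec j)) ≤
        entanglementFidelity s.total (Q.effective Λ) ∧
      entanglementFidelity s.total (Q.effective Λ) ≤ 1 := by
  choose K hK using fun j i => (P.enc_cp j i).exists_kraus
  choose ι hι T hT hfid using fun j => exists_fidelity_formula hΛ s (P.dec_channel j)
  have henc (j : Fin P.numMsg) : P.enc j = fun i => krausMap (K j i) := funext (hK j)
  have hρ := s.posSemidef_senderStates
  have hρ1 := s.trace_senderStates
  set ρ := piKron s.senderState with hρdef
  let A (t : Fin P.numMsg × ∀ i, SenderSpace l d n i × Blk (a i) n) :=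
    piKron fun i => K t.1 i (t.2 i)
  have hF : entanglementFidelity s.total (P.effective Λ) =
      ∑ t, ∑ q, ‖(T t.1 q * A t * ρ).trace‖ ^ 2 := by
    rw [ForwardCode.effective, entanglementFidelity_sum, Fintype.sum_prod_type]
    refine Finset.sum_congr rfl fun j _ => ?_
    rw [henc, hfid]
  have hp : ∑ t, (A t * ρ * (A t)ᴴ).trace.re = 1 := by
    have h := P.enc_tp ρ
    simp only [henc, tensorMap_krausMap, LinearMap.sum_apply, krausMap_apply, Matrix.trace_sum,
      hρ1] at h
    rw [← Complex.re_sum, Fintype.sum_prod_type, h, Complex.one_re]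
  obtain ⟨⟨j, t⟩, hpos, hj⟩ := exists_pos_mul_sum_le
    (p := fun t => (A t * ρ * (A t)ᴴ).trace.re)
    (f := fun t => ∑ q, ‖(T t.1 q * A t * ρ).trace‖ ^ 2)
    (fun t => Finset.sum_nonneg fun _ _ => sq_nonneg _)
    (fun t => by
      have := sum_norm_trace_sq_le (hT t.1) hρ (A t)
      rwa [hρ1, Complex.one_re, one_mul] at this) hp
  rw [← hF] at hj
  -- Polar decompositions are taken sender by sender, so that `W` is a product.
  choose W Pp hW hPp hWP hPW using fun i => exists_polar (K j i (t i) * s.senderState i)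
  -- A branch of positive probability needs a nonzero channel input space.
  have hne (i : Fin k) : Nonempty (Blk (a i) n) := by
    by_contra h
    have : IsEmpty (∀ i, Blk (a i) n) := ⟨fun y => h ⟨y i⟩⟩
    simp [Matrix.trace] at hpos
  choose C hCW hC using fun i => (hW i).exists_kraus_option
  have hchan (i : Fin k) : IsChannel (krausMap (C i)) :=
    ⟨isCompletelyPositive_krausMap _, isTracePreserving_krausMap.2 (hC i)⟩
  let Q : ZeroWayCode a b l dst d n := ⟨fun i => krausMap (C i), P.dec j, hchan, P.dec_channel j⟩
  have hFW : entanglementFidelity s.total (endToEnd Λ (fun i => conjBy (W i)) (P.dec j)) =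
      ∑ q, ‖(T j q * piKron W * ρ).trace‖ ^ 2 := by
    simp only [conjBy_eq_krausMap]
    rw [hfid, Fintype.sum_unique]
  refine ⟨j, Q, W, rfl, fun i => ⟨hW i, ?_⟩, ?_, ?_, ?_, ?_⟩
  · have : Q.enc i - conjBy (W i) = krausMap fun x => C i (some x) := by
      change krausMap (C i) - _ = _
      rw [krausMap, Fintype.sum_option, hCW, add_sub_cancel_left, krausMap]
    rw [this]
    exact isCompletelyPositive_krausMap _
  · rw [hFW]
    refine sqrt_fidelity_polar_ge (hT j) hρ hρ1 (isPartialIsometry_piKron hW)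
      (posSemidef_piKron hPp) ?_ ?_ hpos hj
    · simp only [A, ρ, piKron_mul]
      exact congrArg piKron (funext hWP)
    · simp only [A, ρ, piKron_mul, piKron_conjTranspose]
      exact congrArg piKron (funext hPW)
  · rw [hFW]
    exact Finset.sum_nonneg fun _ _ => sq_nonneg _
  · -- `⨂ᵢ Wᵢ` is the branch of the completed encoding in which every index is `none`.
    have hQ : entanglementFidelity s.total (Q.effective Λ) = _ := hfid j _ C
    rw [hFW, hQ]
    refine le_of_eq_of_le ?_ (Finset.single_le_sum (fun _ _ => Finset.sum_nonneg fun _ _ =>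
      sq_nonneg _) (Finset.mem_univ fun i => (none : Option (SenderSpace l d n i))))
    simp only [hCW, ρ]
  · exact (isKrausChannel_endToEnd hΛ hchan (P.dec_channel j)).entanglementFidelity_le_one
      s.trace_reduced_total

/-- A zero-way code as a forward-assisted code with a single message. -/
def ZeroWayCode.toForwardCode (P : ZeroWayCode a b l dst d n) : ForwardCode a b l dst d n where
  numMsg := 1
  enc _ := P.enc
  dec _ := P.dec
  enc_cp _ i := (P.enc_channel i).1
  enc_tp := by
    simpa using (isKrausChannel_tensorMap fun i =>
      (P.enc_channel i).isKrausChannel).isTracePreserving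
  dec_channel _ := P.dec_channel

theorem ZeroWayCode.toForwardCode_isLocal (P : ZeroWayCode a b l dst d n) :
    P.toForwardCode.IsLocal :=
  ⟨fun _ => 1, Equiv.ofUnique (Fin 1) _, fun i _ => P.enc i,
    fun i => by simpa using (P.enc_channel i).2, fun _ _ => rfl⟩

theorem ZeroWayCode.effective_toForwardCode (P : ZeroWayCode a b l dst d n)
    (Λ : Superop (ChIn a) (ChOut b)) : P.toForwardCode.effective Λ = P.effective Λ :=
  Fintype.sum_unique (ι := Fin 1) _

theorem forwardRegion_subset_jointForwardRegion (Λ : Superop (ChIn a) (ChOut b)) (l : Fin k → ℕ)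
    (dst : Flow l → Fin m) : forwardRegion Λ l dst ⊆ jointForwardRegion Λ l dst :=
  fun _ ⟨d, s, P, _, hR, hF⟩ => ⟨d, s, P, hR, hF⟩

theorem zeroWayRegion_subset_forwardRegion (Λ : Superop (ChIn a) (ChOut b)) (l : Fin k → ℕ)
    (dst : Flow l → Fin m) : zeroWayRegion Λ l dst ⊆ forwardRegion Λ l dst :=
  fun _ ⟨d, s, P, hR, hF⟩ => ⟨d, s, fun n => (P n).toForwardCode,
    fun n => (P n).toForwardCode_isLocal, hR, by
      simpa only [ZeroWayCode.effective_toForwardCode] using hF⟩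

/-- A reliable sequence of forward-assisted codes yields a reliable sequence of zero-way codes for
the same source, with partially isometric branches. -/
theorem exists_reliable_zeroWayCode {Λ : Superop (ChIn a) (ChOut b)} (hΛ : IsChannel Λ)
    (s : ∀ n, BlockSource l d n) (P : ∀ n, ForwardCode a b l dst d n)
    (h : Tendsto (fun n => entanglementFidelity (s n).total ((P n).effective Λ)) atTop (𝓝 1)) :
    ∃ (j : ∀ n, Fin (P n).numMsg) (Q : ∀ n, ZeroWayCode a b l dst d n)
      (W : ∀ n, ∀ i, Matrix (Blk (a i) n) (SenderSpace l d n i) ℂ),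
      (∀ n, (Q n).dec = (P n).dec (j n)) ∧
      (∀ n i, IsPartialIsometry (W n i) ∧
        IsCompletelyPositive ((Q n).enc i - conjBy (W n i))) ∧
      Tendsto (fun n => entanglementFidelity (s n).total
        (endToEnd Λ (fun i => conjBy (W n i)) ((P n).dec (j n)))) atTop (𝓝 1) ∧
      Tendsto (fun n => entanglementFidelity (s n).total ((Q n).effective Λ)) atTop (𝓝 1) := by
  choose j Q W hdec hW hge h0 hWQ hQ using fun n => (P n).exists_zeroWayCode hΛ (s n)
  have hlow : Tendsto (fun n => √(entanglementFidelity (s n).total ((P n).effective Λ)) -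
      √(2 * (1 - √(entanglementFidelity (s n).total ((P n).effective Λ))))) atTop (𝓝 1) := by
    have hc : Continuous fun x : ℝ => √x - √(2 * (1 - √x)) := by fun_prop
    have h1 := hc.tendsto 1
    simp only [Real.sqrt_one, sub_self, mul_zero, Real.sqrt_zero, sub_zero] at h1
    exact h1.comp h
  have hsq := tendsto_of_tendsto_of_tendsto_of_le_of_le hlow tendsto_const_nhds hge
    fun n => Real.sqrt_le_one.2 ((hWQ n).trans (hQ n))
  have hWlim : Tendsto (fun n => entanglementFidelity (s n).total
      (endToEnd Λ (fun i => conjBy (W n i)) ((P n).dec (j n)))) atTop (𝓝 1) := by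
    have := hsq.pow 2
    rw [one_pow] at this
    exact this.congr fun n => Real.sq_sqrt (h0 n)
  exact ⟨j, Q, W, hdec, hW, hWlim,
    tendsto_of_tendsto_of_tendsto_of_le_of_le hWlim tendsto_const_nhds hWQ hQ⟩

theorem jointForwardRegion_subset_zeroWayRegion {Λ : Superop (ChIn a) (ChOut b)}
    (hΛ : IsChannel Λ) (l : Fin k → ℕ) (dst : Flow l → Fin m) :
    jointForwardRegion Λ l dst ⊆ zeroWayRegion Λ l dst := by
  rintro R ⟨d, s, P, hR, hF⟩
  obtain ⟨-, Q, -, -, -, -, hQ⟩ := exists_reliable_zeroWayCode hΛ s P hF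
  exact ⟨d, s, Q, hR, hQ⟩

end Network

end MultiUser

end

theorem mainTheorem2 {k m : ℕ} (a : Fin k → ℕ) (b : Fin m → ℕ)
    (Λ : MultiUser.Superop (ChIn a) (ChOut b)) (hΛ : IsChannel Λ)
    (l : Fin k → ℕ) (dst : Flow l → Fin m) :
    forwardRegion Λ l dst = zeroWayRegion Λ l dst ∧
    jointForwardRegion Λ l dst = zeroWayRegion Λ l dst ∧
    (∀ (d : Flow l → ℕ) (s : ∀ n, BlockSource l d n) (P : ∀ n, ForwardCode a b l dst d n),
      Tendsto (fun n => entanglementFidelity (s n).total ((P n).effective Λ)) atTop (𝓝 1) →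
      ∃ (j : ∀ n, Fin (P n).numMsg) (Q : ∀ n, ZeroWayCode a b l dst d n)
        (W : ∀ n, ∀ i, Matrix (Blk (a i) n) (SenderSpace l d n i) ℂ),
        (∀ n, (Q n).dec = (P n).dec (j n)) ∧
        (∀ n i, IsPartialIsometry (W n i) ∧
          IsCompletelyPositive ((Q n).enc i - conjBy (W n i))) ∧
        Tendsto (fun n => entanglementFidelity (s n).total
          (endToEnd Λ (fun i => conjBy (W n i)) ((P n).dec (j n)))) atTop (𝓝 1) ∧
        Tendsto (fun n => entanglementFidelity (s n).total ((Q n).effective Λ)) atTop (𝓝 1)) := by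
  have h₁ := zeroWayRegion_subset_forwardRegion Λ l dst
  have h₂ := forwardRegion_subset_jointForwardRegion Λ l dst
  have h₃ := jointForwardRegion_subset_zeroWayRegion hΛ l dst
  exact ⟨(h₂.trans h₃).antisymm h₁, h₃.antisymm (h₁.trans h₂),
    fun _ s P h => exists_reliable_zeroWayCode hΛ s P h⟩
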